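/- Let $\mathcal H_{d,+,1}$ be the set of $d\times d$ (complex) density matrices. A set $\mathcal F\subseteq\mathcal H_{d,+,1}$ is called affine if every density matrix of the form $\sum_i t_i\sigma_i$ (finite sum, $t_i\in\mathbb R$, $\sigma_i\in\mathcal F$) belongs to $\mathcal F$, and its dual set is $$\mathcal F^\star=\{\omega\in\mathcal H_{d,+,1}\;:\;\mathrm{Tr}[\omega\sigma]=\mathrm{Tr}[\omega\sigma']\ \ \forall\,\sigma,\sigma'\in\mathcal F\}.$$ For a density matrix $\Omega^{AB}$ on $\mathbb C^{d'}\otimes\mathbb C^{d}$ let $H_{\min}(A|B)_\Omega=-\log_2\min\{\mathrm{Tr}[\tau] : \tau\ge 0,\ I_{d'}\otimes\tau\ge\Omega^{AB}\}$. Let $\mathcal F_{\rm in}\subseteq\mathcal H_{d,+,1}$ and $\mathcal F_{\rm out}\subseteq\mathcal H_{d',+,1}$ be affine sets (the free states at the input and at the output), with $\mathcal F_{\rm in}\neq\emptyset$, and suppose that the maximally mixed state $\frac1{d'}I_{d'}$ belongs to $\mathcal F_{\rm out}$. Let $n=\dim\mathcal V_{\rm in}$, where $\mathcal V_{\rm in}=\mathrm{span}_{\mathbb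 R}\,\mathcal F_{\rm in}$. Let $\rho\in\mathcal H_{d,+,1}$ and $\rho'\in\mathcal H_{d',+,1}$. For $\eta\in\mathcal H_{d',+,1}$, $\omega_1,\dots,\omega_n\in\mathcal F_{\rm out}^\star$ and $\sigma_1,\dots,\sigma_n\in\mathcal F_{\rm in}$ put $$\Omega(\rho)=\Omega^{AB}_{\eta,\omega,\sigma}(\rho)=\frac1{n+1}\Big(\eta^T\otimes\rho+\sum_{\ell=1}^n\omega_\ell^T\otimes\sigma_\ell\Big).$$ Consider the inequality $$2^{-H_{\min}(A|B)_{\Omega(\rho)}}\;\ge\;\frac{n+d'\,\mathrm{Tr}[\eta\rho']}{d'(n+1)}.\qquad(*)$$ 1. Fix any $\sigma_1,\dots,\sigma_n\in\mathcal F_{\rm in}$ with $\mathrm{span}_{\mathbb R}\{\sigma_1,\dots,\sigma_n\}=\mathcal V_{\rm in}$. Then there is a resource non-generating (RNG) operation $\mathcal E$, that is, a completely positive trace preserving map with $\mathcal E(\mathcal F_{\rm in})\subseteq\mathcal F_{\rm out}$, such that $\mathcal E(\rho)=\rho'$, if and only if $(*)$ holds for all $\eta\in\mathcal H_{d',+,1}$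 and all $\omega_1,\dots,\omega_n\in\mathcal F_{\rm out}^\star$. 2. There is an RNG operation $\mathcal E$ with $\mathcal E(\rho)=\rho'$ if and only if $(*)$ holds for all $\eta\in\mathcal H_{d',+,1}$, all $\omega_1,\dots,\omega_n\in\mathcal F_{\rm out}^\star$ and all $\sigma_1,\dots,\sigma_n\in\mathcal F_{\rm in}$. -/

import Mathlib

open scoped Matrix Kronecker ComplexOrder

noncomputable section

/-- The set of `d × d` density matrices. -/
def densityMatrices (d : ℕ) : Set (Matrix (Fin d) (Fin d) ℂ) :=
  {ρ | ρ.PosSemidef ∧ ρ.trace = 1}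

/-- The maximally mixed state `I / d`. -/
def maximallyMixed (d : ℕ) : Matrix (Fin d) (Fin d) ℂ :=
  (d : ℂ)⁻¹ • (1 : Matrix (Fin d) (Fin d) ℂ)

/-- A set of density matrices is affine if it contains every density matrix that is a finite real
linear combination of its elements. (The coefficients of such a combination automatically sum to
one, because all the traces are one.) -/
def IsAffineStateSet {d : ℕ} (F : Set (Matrix (Fin d) (Fin d) ℂ)) : Prop :=
  F ⊆ densityMatrices d ∧
    ∀ (k : ℕ) (t : Fin k → ℝ) (σ : Fin k → Matrix (Fin d) (Fin d) ℂ),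
      (∀ i, σ i ∈ F) → ∑ i, t i • σ i ∈ densityMatrices d → ∑ i, t i • σ i ∈ F

/-- The dual set of `F`: the density matrices whose Hilbert–Schmidt product with the elements of
`F` is constant. -/
def dualStates {d : ℕ} (F : Set (Matrix (Fin d) (Fin d) ℂ)) : Set (Matrix (Fin d) (Fin d) ℂ) :=
  {ω | ω ∈ densityMatrices d ∧ ∀ σ ∈ F, ∀ σ' ∈ F, (ω * σ).trace = (ω * σ').trace}

/-- The real linear span of a set of states. -/
def realSpan {d : ℕ} (F : Set (Matrix (Fin d) (Fin d) ℂ)) :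
    Submodule ℝ (Matrix (Fin d) (Fin d) ℂ) :=
  Submodule.span ℝ F

/-- The dimension of the real linear span of a set of states. -/
def spanDim {d : ℕ} (F : Set (Matrix (Fin d) (Fin d) ℂ)) : ℕ :=
  Module.finrank ℝ (realSpan F)

/-- The map `id_k ⊗ E`, which applies `E` to each of the `k × k` blocks. -/
def ampliate {d d' : ℕ} (k : ℕ)
    (E : Matrix (Fin d) (Fin d) ℂ →ₗ[ℂ] Matrix (Fin d') (Fin d') ℂ)
    (X : Matrix (Fin k × Fin d) (Fin k × Fin d) ℂ) :
    Matrix (Fin k × Fin d') (Fin k × Fin d') ℂ :=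
  Matrix.of fun p q => E (Matrix.of fun i j => X (p.1, i) (q.1, j)) p.2 q.2

/-- Quantum channels: completely positive and trace preserving linear maps. -/
def IsChannel {d d' : ℕ}
    (E : Matrix (Fin d) (Fin d) ℂ →ₗ[ℂ] Matrix (Fin d') (Fin d') ℂ) : Prop :=
  (∀ (k : ℕ) (X : Matrix (Fin k × Fin d) (Fin k × Fin d) ℂ),
      X.PosSemidef → (ampliate k E X).PosSemidef) ∧
    ∀ X, (E X).trace = X.trace

/-- Resource non-generating operations: channels that map free states to free states. -/
def IsRNG {d d' : ℕ} (FIn : Set (Matrix (Fin d) (Fin d) ℂ))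
    (FOut : Set (Matrix (Fin d') (Fin d') ℂ))
    (E : Matrix (Fin d) (Fin d) ℂ →ₗ[ℂ] Matrix (Fin d') (Fin d') ℂ) : Prop :=
  IsChannel E ∧ ∀ σ ∈ FIn, E σ ∈ FOut

/-- The conditional min-entropy
`H_min(A|B)_Ω = -log₂ min {Tr τ | τ ≥ 0, I ⊗ τ ≥ Ω}`, with `A` of dimension `a` and `B` of
dimension `b`. -/
def condMinEntropy {a b : ℕ} (Ω : Matrix (Fin a × Fin b) (Fin a × Fin b) ℂ) : ℝ :=
  -Real.logb 2 (sInf {r : ℝ | ∃ τ : Matrix (Fin b) (Fin b) ℂ, τ.PosSemidef ∧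
    ((1 : Matrix (Fin a) (Fin a) ℂ) ⊗ₖ τ - Ω).PosSemidef ∧ r = τ.trace.re})

/-- The separable matrix `Θ = (1/n) ∑ ω_ℓᵀ ⊗ σ_ℓ`. -/
def thetaMatrix {a b n : ℕ} (ω : Fin n → Matrix (Fin a) (Fin a) ℂ)
    (σ : Fin n → Matrix (Fin b) (Fin b) ℂ) : Matrix (Fin a × Fin b) (Fin a × Fin b) ℂ :=
  (n : ℂ)⁻¹ • ∑ l, (ω l)ᵀ ⊗ₖ σ l

/-- The separable matrix `Ω(ρ) = (ηᵀ ⊗ ρ + n Θ) / (n + 1)`. -/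
def omegaMatrix {a b n : ℕ} (η : Matrix (Fin a) (Fin a) ℂ)
    (ω : Fin n → Matrix (Fin a) (Fin a) ℂ) (σ : Fin n → Matrix (Fin b) (Fin b) ℂ)
    (ρ : Matrix (Fin b) (Fin b) ℂ) : Matrix (Fin a × Fin b) (Fin a × Fin b) ℂ :=
  ((n : ℂ) + 1)⁻¹ • (ηᵀ ⊗ₖ ρ + (n : ℂ) • thetaMatrix ω σ)

end

/-! The inequality is semidefinite duality for the search for the channel. Necessity: for a channel
`E`, pairing `(id ⊗ E)(Z)` with the unnormalized maximally entangled vector is nonnegative for `Z ≥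
0`, sends `Yᵀ ⊗ X` to `Tr[Y E(X)]` and `1 ⊗ τ` to `Tr τ`. Applied to `1 ⊗ τ - Ω ≥ 0`, it bounds `Tr
τ` below; each free term contributes `1/d'`, because a dual state has the same overlap with every
free state as with the maximally mixed one (`IsRNG.le_two_rpow_neg_condMinEntropy`). Sufficiency: a
suitable Choi matrix is a point of a compact convex set whose image under a linear map lies in a
closed affine subspace. If there is none, Hahn-Banach separation yields Hermitian `H`, `X l` and `τ`
(`exists_choi_or_certificate`). With `H` and the `X l` traceless, small perturbations of the
maximally mixed state along them are a state `η` and dual states `ω l` violating the inequality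
(`exists_two_rpow_neg_condMinEntropy_lt`). Affinity of the output set makes it enough that free
states land in its real span, a linear condition that need only be tested on a spanning family. -/

instance Matrix.instLocallyConvexSpaceReal {m n : Type*} : LocallyConvexSpace ℝ (Matrix m n ℂ) :=
  inferInstanceAs (LocallyConvexSpace ℝ (m → n → ℂ))

/-! ### Positive semidefinite matrices: compactness, and functionals as trace pairings. -/

section PosSemidef

variable {m : Type*} [Fintype m]

open scoped Matrix.Norms.L2Operator MatrixOrder in
theorem Matrix.IsHermitian.exists_smul_one_add_posSemidef [DecidableEq m] {H : Matrix m m ℂ}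
    (hH : H.IsHermitian) :
    ∃ c : ℝ, 0 < c ∧ ∀ c', c ≤ c' → (c' • (1 : Matrix m m ℂ) + H).PosSemidef := by
  refine ⟨‖H‖ + 1, by positivity, fun c' hc => ?_⟩
  have h := IsSelfAdjoint.neg_algebraMap_norm_le_self (a := H) hH
  rw [Matrix.le_iff] at h
  have h2 : ((c' - ‖H‖) • (1 : Matrix m m ℂ)).PosSemidef :=
    Matrix.PosSemidef.one.smul (by linarith)
  have h3 : c' • (1 : Matrix m m ℂ) + H
      = (H - -(algebraMap ℝ (Matrix m m ℂ)) ‖H‖) + (c' - ‖H‖) • (1 : Matrix m m ℂ) := by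
    rw [Algebra.algebraMap_eq_smul_one, sub_smul]
    abel
  rw [h3]
  exact h.add h2

open scoped Matrix.Norms.L2Operator MatrixOrder in
theorem Matrix.PosSemidef.exists_conjTranspose_mul_self [DecidableEq m] {J : Matrix m m ℂ} (hJ : J.PosSemidef) :
    ∃ G : Matrix m m ℂ, J = Gᴴ * G := by
  obtain ⟨G, hG⟩ := CStarAlgebra.nonneg_iff_eq_star_mul_self.mp (Matrix.nonneg_iff_posSemidef.mpr hJ)
  exact ⟨G, hG⟩

/-- This is the continuous image under `G ↦ Gᴴ * G` of a closed set, bounded because the trace of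
`Gᴴ * G` is the sum of the squared moduli of the entries of `G`. -/
theorem Matrix.isCompact_posSemidef_trace [DecidableEq m] (c : ℝ) :
    IsCompact {J : Matrix m m ℂ | J.PosSemidef ∧ J.trace = c} := by
  have hK : IsCompact {G : Matrix m m ℂ | (Gᴴ * G).trace = c} := by
    have hB : @IsCompact (Matrix m m ℂ) _ (Set.univ.pi fun _ : m => Set.univ.pi fun _ : m =>
        Metric.closedBall (0 : ℂ) (Real.sqrt c)) :=
      isCompact_univ_pi fun _ => isCompact_univ_pi fun _ => isCompact_closedBall _ _
    refine hB.of_isClosed_subset ?_ ?_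
    · exact isClosed_eq (by fun_prop) continuous_const
    · intro G hG i _ j _
      have h1 : ∑ j, ∑ i, ‖G i j‖ ^ 2 = c := by
        have h0 : (Gᴴ * G).trace = ((∑ j, ∑ i, ‖G i j‖ ^ 2 : ℝ) : ℂ) := by
          simp only [Matrix.trace, Matrix.diag, Matrix.mul_apply, Matrix.conjTranspose_apply]
          push_cast
          refine Finset.sum_congr rfl fun j _ => Finset.sum_congr rfl fun i _ => ?_
          exact Complex.conj_mul' _
        have hG' : (Gᴴ * G).trace = c := hG
        rw [h0] at hG'
        exact_mod_cast hG'
      have h2 : ‖G i j‖ ^ 2 ≤ c := by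
        rw [← h1]
        exact (Finset.single_le_sum (f := fun i => ‖G i j‖ ^ 2) (fun _ _ => by positivity)
          (Finset.mem_univ i)).trans
          (Finset.single_le_sum (f := fun j => ∑ i, ‖G i j‖ ^ 2)
            (fun _ _ => Finset.sum_nonneg fun _ _ => by positivity) (Finset.mem_univ j))
      rw [mem_closedBall_zero_iff]
      exact Real.le_sqrt_of_sq_le h2
  have himg : {J : Matrix m m ℂ | J.PosSemidef ∧ J.trace = c}
      = (fun G : Matrix m m ℂ => Gᴴ * G) '' {G : Matrix m m ℂ | (Gᴴ * G).trace = c} := by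
    ext J
    constructor
    · rintro ⟨hJ, ht⟩
      obtain ⟨G, rfl⟩ := hJ.exists_conjTranspose_mul_self
      exact ⟨G, ht, rfl⟩
    · rintro ⟨G, ht, rfl⟩
      exact ⟨Matrix.posSemidef_conjTranspose_mul_self G, ht⟩
  rw [himg]
  exact hK.image (by fun_prop)

theorem Matrix.convex_posSemidef_trace (c : ℝ) :
    Convex ℝ {J : Matrix m m ℂ | J.PosSemidef ∧ J.trace = c} := by
  rintro J ⟨hJ, tJ⟩ K ⟨hK, tK⟩ a b ha hb hab
  refine ⟨(hJ.smul ha).add (hK.smul hb), ?_⟩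
  rw [Matrix.trace_add, Matrix.trace_smul, Matrix.trace_smul, tJ, tK, ← add_smul, hab, one_smul]

theorem Matrix.IsHermitian.trace_mul_im {H Y : Matrix m m ℂ} (hH : H.IsHermitian)
    (hY : Y.IsHermitian) : (H * Y).trace.im = 0 := by
  have h : star (H * Y).trace = (H * Y).trace := by
    rw [← Matrix.trace_conjTranspose, Matrix.conjTranspose_mul, hH.eq, hY.eq, Matrix.trace_mul_comm]
  exact Complex.conj_eq_iff_im.mp h

/-- Real functionals on complex matrices are, on Hermitian matrices, Hilbert–Schmidt products with
a Hermitian matrix. -/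
theorem Matrix.exists_isHermitian_forall_eq_trace_mul [DecidableEq m] (f : Matrix m m ℂ →ₗ[ℝ] ℝ) :
    ∃ H : Matrix m m ℂ, H.IsHermitian ∧
      ∀ Y : Matrix m m ℂ, Y.IsHermitian → f Y = (H * Y).trace.re := by
  -- For real `p`, `q` one has `Re((p - iq)(x + iy)) = px + qy`, so each entry of `M` encodes the
  -- values of `f` on a matrix unit and on `i` times it.
  let M : Matrix m m ℂ := Matrix.of fun b a =>
    (f (Matrix.single a b 1) : ℂ) - Complex.I * f (Matrix.single a b Complex.I)
  have hM : ∀ Y : Matrix m m ℂ, f Y = (M * Y).trace.re := by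
    intro Y
    have hY : Y = ∑ a, ∑ b, ((Y a b).re • Matrix.single a b (1 : ℂ)
        + (Y a b).im • Matrix.single a b Complex.I) := by
      conv_lhs => rw [Matrix.matrix_eq_sum_single Y]
      refine Finset.sum_congr rfl fun a _ => Finset.sum_congr rfl fun b _ => ?_
      rw [Matrix.smul_single, Matrix.smul_single, ← Matrix.single_add]
      congr 1
      simp [Complex.re_add_im]
    conv_lhs => rw [hY]
    simp only [map_sum, map_add, map_smul, smul_eq_mul, Matrix.trace, Matrix.diag,
      Matrix.mul_apply, Complex.re_sum]
    rw [Finset.sum_comm]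
    refine Finset.sum_congr rfl fun b _ => Finset.sum_congr rfl fun a _ => ?_
    simp [M]
    ring
  -- Against Hermitian `Y` only the Hermitian part of `M` contributes to the real part.
  refine ⟨(2⁻¹ : ℝ) • (M + Mᴴ), ?_, fun Y hY => ?_⟩
  · unfold Matrix.IsHermitian
    rw [Matrix.conjTranspose_smul, Matrix.conjTranspose_add, Matrix.conjTranspose_conjTranspose,
      add_comm, star_trivial]
  · have h : (Mᴴ * Y).trace.re = (M * Y).trace.re := by
      have : (Mᴴ * Y).trace = star (M * Y).trace := by
        rw [← Matrix.trace_conjTranspose, Matrix.conjTranspose_mul, hY.eq, Matrix.trace_mul_comm]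
      rw [this]
      rfl
    rw [hM, Matrix.smul_mul, Matrix.trace_smul, Matrix.add_mul, Matrix.trace_add, Complex.smul_re,
      Complex.add_re, h, smul_eq_mul]
    ring

/-- A Hermitian matrix is bounded by a multiple of the identity as soon as its expectation values
are. -/
theorem Matrix.IsHermitian.smul_one_sub_posSemidef [DecidableEq m] {M : Matrix m m ℂ} (hM : M.IsHermitian) (c : ℝ)
    (h : ∀ J : Matrix m m ℂ, J.PosSemidef → (J * M).trace.re ≤ c * J.trace.re) :
    (c • (1 : Matrix m m ℂ) - M).PosSemidef := by
  have hH : (c • (1 : Matrix m m ℂ) - M).IsHermitian :=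
    (Matrix.isHermitian_one.smul (IsSelfAdjoint.all c)).sub hM
  refine Matrix.PosSemidef.of_dotProduct_mulVec_nonneg hH fun v => ?_
  have hv := h _ (Matrix.posSemidef_vecMulVec_self_star v)
  have e : star v ⬝ᵥ (c • (1 : Matrix m m ℂ) - M) *ᵥ v
      = (Matrix.vecMulVec v (star v) * (c • (1 : Matrix m m ℂ) - M)).trace := by
    rw [Matrix.vecMulVec_mul, Matrix.trace_vecMulVec, Matrix.dotProduct_mulVec, dotProduct_comm]
  rw [e, Complex.le_def]
  refine ⟨?_, ?_⟩
  · rw [Matrix.mul_sub, Matrix.trace_sub, Matrix.mul_smul, Matrix.mul_one, Matrix.trace_smul]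
    simpa using hv
  · exact ((Matrix.posSemidef_vecMulVec_self_star v).isHermitian.trace_mul_im hH).symm

end PosSemidef

/-! ### Choi matrices and channels. -/

section Choi

variable {d d' : ℕ}

/-- The linear map `E` with `Tr[Y E(X)] = Tr[J (Yᵀ ⊗ X)]`. -/
def choiMap (J : Matrix (Fin d' × Fin d) (Fin d' × Fin d) ℂ) :
    Matrix (Fin d) (Fin d) ℂ →ₗ[ℂ] Matrix (Fin d') (Fin d') ℂ where
  toFun X := Matrix.of fun a b => ∑ i, ∑ j, J (b, j) (a, i) * X i j
  map_add' X Y := by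
    ext a b
    simp [mul_add, Finset.sum_add_distrib]
  map_smul' c X := by
    ext a b
    simp [Finset.mul_sum, mul_left_comm]

/-- The partial trace over the first factor. -/
def partialTraceLeft (J : Matrix (Fin d' × Fin d) (Fin d' × Fin d) ℂ) :
    Matrix (Fin d) (Fin d) ℂ :=
  Matrix.of fun j i => ∑ a, J (a, j) (a, i)

theorem choiMap_apply (J : Matrix (Fin d' × Fin d) (Fin d' × Fin d) ℂ)
    (X : Matrix (Fin d) (Fin d) ℂ) (a b : Fin d') :
    choiMap J X a b = ∑ i, ∑ j, J (b, j) (a, i) * X i j := rfl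

theorem partialTraceLeft_apply (J : Matrix (Fin d' × Fin d) (Fin d' × Fin d) ℂ) (j i : Fin d) :
    partialTraceLeft J j i = ∑ a, J (a, j) (a, i) := rfl

theorem trace_mul_choiMap (J : Matrix (Fin d' × Fin d) (Fin d' × Fin d) ℂ)
    (X : Matrix (Fin d) (Fin d) ℂ) (Y : Matrix (Fin d') (Fin d') ℂ) :
    (Y * choiMap J X).trace = (J * (Yᵀ ⊗ₖ X)).trace := by
  simp only [Matrix.trace, Matrix.diag, Matrix.mul_apply, choiMap_apply, Fintype.sum_prod_type,
    Matrix.kroneckerMap_apply, Matrix.transpose_apply, Finset.mul_sum]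
  refine Finset.sum_congr rfl fun b _ => ?_
  rw [Finset.sum_comm (γ := Fin d)]
  refine Finset.sum_congr rfl fun a _ => ?_
  rw [Finset.sum_comm]
  exact Finset.sum_congr rfl fun j _ => Finset.sum_congr rfl fun i _ => by ring

theorem trace_mul_partialTraceLeft (J : Matrix (Fin d' × Fin d) (Fin d' × Fin d) ℂ)
    (T : Matrix (Fin d) (Fin d) ℂ) :
    (T * partialTraceLeft J).trace = (J * ((1 : Matrix (Fin d') (Fin d') ℂ) ⊗ₖ T)).trace := by
  simp only [Matrix.trace, Matrix.diag, Matrix.mul_apply, partialTraceLeft_apply,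
    Fintype.sum_prod_type, Matrix.kroneckerMap_apply, Matrix.one_apply, Finset.mul_sum, ite_mul,
    mul_ite, zero_mul, mul_zero, one_mul]
  have h : ∀ (a : Fin d') (j : Fin d),
      (∑ b, ∑ i, if b = a then J (a, j) (b, i) * T i j else 0) = ∑ i, J (a, j) (a, i) * T i j := by
    intro a j
    rw [Finset.sum_comm]
    simp
  simp only [h]
  rw [Finset.sum_comm]
  symm
  rw [Finset.sum_comm]
  refine Finset.sum_congr rfl fun j _ => ?_
  rw [Finset.sum_comm]
  exact Finset.sum_congr rfl fun a _ => Finset.sum_congr rfl fun i _ => by ring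

theorem isLinearMap_partialTraceLeft :
    IsLinearMap ℝ (partialTraceLeft : Matrix (Fin d' × Fin d) (Fin d' × Fin d) ℂ → _) := by
  constructor
  · intro J K
    ext i j
    simp [partialTraceLeft_apply, Finset.sum_add_distrib]
  · intro c J
    ext i j
    simp [partialTraceLeft_apply, Finset.mul_sum]

theorem isLinearMap_choiMap_apply (X : Matrix (Fin d) (Fin d) ℂ) :
    IsLinearMap ℝ fun J : Matrix (Fin d' × Fin d) (Fin d' × Fin d) ℂ => choiMap J X := by
  constructor
  · intro J K
    ext i j
    simp [choiMap_apply, Finset.sum_add_distrib, add_mul]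
  · intro c J
    ext i j
    simp [choiMap_apply, Finset.mul_sum, mul_assoc]

/-- With `J = Gᴴ * G`, each row of `G`, reshaped into a `d' × d` matrix, is a Kraus operator; the `K
r` below are these operators tensored with the identity. -/
theorem isChannel_choiMap {J : Matrix (Fin d' × Fin d) (Fin d' × Fin d) ℂ} (hJ : J.PosSemidef)
    (hT : partialTraceLeft J = 1) : IsChannel (choiMap J) := by
  constructor
  · intro k X hX
    obtain ⟨G, rfl⟩ := hJ.exists_conjTranspose_mul_self
    let K : Fin d' × Fin d → Matrix (Fin k × Fin d') (Fin k × Fin d) ℂ := fun r =>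
      Matrix.of fun p q => if p.1 = q.1 then G r (p.2, q.2) else 0
    have h : ampliate k (choiMap (Gᴴ * G)) X = ∑ r, K r * X * (K r)ᴴ := by
      ext ⟨p, a⟩ ⟨q, b⟩
      have hr : ∀ r, (K r * X * (K r)ᴴ) (p, a) (q, b)
          = ∑ j, ∑ i, G r (a, i) * X (p, i) (q, j) * star (G r (b, j)) := by
        intro r
        simp only [Matrix.mul_apply, Matrix.conjTranspose_apply, K, Matrix.of_apply,
          Fintype.sum_prod_type, Finset.sum_mul]
        rw [Finset.sum_eq_single q (fun q' _ hq => by simp [hq.symm]) (by simp)]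
        refine Finset.sum_congr rfl fun j _ => ?_
        rw [Finset.sum_eq_single p (fun p' _ hp => by simp [hp.symm]) (by simp)]
        simp
      rw [Matrix.sum_apply]
      simp only [hr, ampliate, Matrix.of_apply, choiMap_apply, Matrix.mul_apply,
        Matrix.conjTranspose_apply, Finset.sum_mul]
      rw [Finset.sum_comm]
      symm
      rw [Finset.sum_comm]
      refine Finset.sum_congr rfl fun j _ => ?_
      rw [Finset.sum_comm]
      exact Finset.sum_congr rfl fun i _ => Finset.sum_congr rfl fun r _ => by ring
    rw [h]
    exact Matrix.posSemidef_sum _ fun r _ => hX.mul_mul_conjTranspose_same _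
  · intro X
    have h1 := trace_mul_choiMap J X 1
    rw [Matrix.one_mul, Matrix.transpose_one, ← trace_mul_partialTraceLeft, hT,
      Matrix.mul_one] at h1
    exact h1

theorem IsChannel.map_posSemidef
    {E : Matrix (Fin d) (Fin d) ℂ →ₗ[ℂ] Matrix (Fin d') (Fin d') ℂ} (hE : IsChannel E)
    {X : Matrix (Fin d) (Fin d) ℂ} (hX : X.PosSemidef) : (E X).PosSemidef :=
  (hE.1 1 (X.submatrix Prod.snd Prod.snd) (hX.submatrix _)).submatrix fun i => ((0 : Fin 1), i)

theorem IsChannel.map_densityMatrices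
    {E : Matrix (Fin d) (Fin d) ℂ →ₗ[ℂ] Matrix (Fin d') (Fin d') ℂ} (hE : IsChannel E)
    {X : Matrix (Fin d) (Fin d) ℂ} (hX : X ∈ densityMatrices d) : E X ∈ densityMatrices d' :=
  ⟨hE.map_posSemidef hX.1, by rw [hE.2, hX.2]⟩

/-- The unnormalized overlap of `(id ⊗ E)(X)` with the maximally entangled vector. -/
def entangledOverlap (E : Matrix (Fin d) (Fin d) ℂ →ₗ[ℂ] Matrix (Fin d') (Fin d') ℂ) :
    Matrix (Fin d' × Fin d) (Fin d' × Fin d) ℂ →ₗ[ℂ] ℂ where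
  toFun X := ∑ a, ∑ b, ampliate d' E X (a, a) (b, b)
  map_add' X Y := by
    simp only [← Finset.sum_add_distrib]
    refine Finset.sum_congr rfl fun a _ => Finset.sum_congr rfl fun b _ => ?_
    exact congrFun₂ (E.map_add (Matrix.of fun i j => X (a, i) (b, j))
      (Matrix.of fun i j => Y (a, i) (b, j))) a b
  map_smul' c X := by
    simp only [RingHom.id_apply, smul_eq_mul, Finset.mul_sum]
    refine Finset.sum_congr rfl fun a _ => Finset.sum_congr rfl fun b _ => ?_
    exact congrFun₂ (E.map_smul c (Matrix.of fun i j => X (a, i) (b, j))) a b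

theorem entangledOverlap_transpose_kronecker
    (E : Matrix (Fin d) (Fin d) ℂ →ₗ[ℂ] Matrix (Fin d') (Fin d') ℂ)
    (Y : Matrix (Fin d') (Fin d') ℂ) (X : Matrix (Fin d) (Fin d) ℂ) :
    entangledOverlap E (Yᵀ ⊗ₖ X) = (Y * E X).trace := by
  have h : ∀ a b, ampliate d' E (Yᵀ ⊗ₖ X) (a, a) (b, b) = Y b a * E X a b := fun a b =>
    congrFun₂ (E.map_smul (Y b a) X) a b
  simp only [entangledOverlap, LinearMap.coe_mk, AddHom.coe_mk, h, Matrix.trace, Matrix.diag,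
    Matrix.mul_apply]
  exact Finset.sum_comm

/-- The overlap is the quadratic form of the ampliation at the vector `∑ a, e_a ⊗ e_a`. -/
theorem entangledOverlap_nonneg
    {E : Matrix (Fin d) (Fin d) ℂ →ₗ[ℂ] Matrix (Fin d') (Fin d') ℂ} (hE : IsChannel E)
    {X : Matrix (Fin d' × Fin d) (Fin d' × Fin d) ℂ} (hX : X.PosSemidef) :
    0 ≤ entangledOverlap E X := by
  have h := (hE.1 d' X hX).dotProduct_mulVec_nonneg fun p => if p.1 = p.2 then 1 else 0
  convert h using 1
  simp [entangledOverlap, dotProduct, Matrix.mulVec, Fintype.sum_prod_type]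

end Choi

/-! ### Affine sets of states and their duals. -/

section FreeStates

variable {d d' : ℕ}

theorem pos_of_mem_densityMatrices {ρ : Matrix (Fin d) (Fin d) ℂ} (hρ : ρ ∈ densityMatrices d) :
    0 < d := by
  rcases Nat.eq_zero_or_pos d with rfl | h
  · have := hρ.2
    simp [Matrix.trace] at this
  · exact h

theorem IsAffineStateSet.mem_of_mem_realSpan {F : Set (Matrix (Fin d) (Fin d) ℂ)}
    (hF : IsAffineStateSet F) {ρ : Matrix (Fin d) (Fin d) ℂ} (hρ : ρ ∈ densityMatrices d)
    (h : ρ ∈ realSpan F) : ρ ∈ F := by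
  obtain ⟨k, t, σ, rfl⟩ := Submodule.mem_span_set'.mp h
  exact hF.2 k t (fun i => σ i) (fun i => (σ i).2) hρ

theorem trace_perturbation_mul (ε : ℝ) (X Y : Matrix (Fin d) (Fin d) ℂ) :
    (((d : ℝ)⁻¹ • (1 + ε • X)) * Y).trace = (d : ℝ)⁻¹ • (Y.trace + ε • (X * Y).trace) := by
  rw [Matrix.smul_mul, Matrix.trace_smul, Matrix.add_mul, Matrix.trace_add, Matrix.one_mul,
    Matrix.smul_mul, Matrix.trace_smul]

theorem perturbation_mem_densityMatrices (hd : 0 < d) {X : Matrix (Fin d) (Fin d) ℂ}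
    (ht : X.trace = 0) {c : ℝ} (hc : 0 < c)
    (hX : (c • (1 : Matrix (Fin d) (Fin d) ℂ) + X).PosSemidef) :
    (d : ℝ)⁻¹ • (1 + c⁻¹ • X) ∈ densityMatrices d := by
  constructor
  · have h : (1 : Matrix (Fin d) (Fin d) ℂ) + c⁻¹ • X = c⁻¹ • (c • 1 + X) := by
      rw [smul_add, smul_smul, inv_mul_cancel₀ hc.ne', one_smul]
    rw [h]
    exact (hX.smul (inv_nonneg.mpr hc.le)).smul (by positivity)
  · rw [Matrix.trace_smul, Matrix.trace_add, Matrix.trace_smul, ht, smul_zero, add_zero,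
      Matrix.trace_one, Fintype.card_fin, Complex.real_smul]
    have : (d : ℂ) ≠ 0 := by exact_mod_cast hd.ne'
    push_cast
    exact inv_mul_cancel₀ this

/-- Free states all have trace one, so the identity has constant overlap with them, and the
perturbation adds nothing. -/
theorem mem_dualStates_of_trace_mul {F : Set (Matrix (Fin d) (Fin d) ℂ)}
    (hF : F ⊆ densityMatrices d) {c : ℝ} {X : Matrix (Fin d) (Fin d) ℂ}
    (hmem : (d : ℝ)⁻¹ • (1 + c • X) ∈ densityMatrices d)
    (hX : ∀ σ ∈ F, (X * σ).trace = 0) : (d : ℝ)⁻¹ • (1 + c • X) ∈ dualStates F := by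
  refine ⟨hmem, fun σ hσ σ' hσ' => ?_⟩
  rw [trace_perturbation_mul, trace_perturbation_mul, hX σ hσ, hX σ' hσ', (hF hσ).2, (hF hσ').2]

theorem trace_mul_eq_of_mem_dualStates {F : Set (Matrix (Fin d) (Fin d) ℂ)}
    (hmix : maximallyMixed d ∈ F) {ω σ : Matrix (Fin d) (Fin d) ℂ} (hω : ω ∈ dualStates F)
    (hσ : σ ∈ F) : (ω * σ).trace = (d : ℂ)⁻¹ := by
  rw [hω.2 σ hσ _ hmix, maximallyMixed, Matrix.mul_smul, Matrix.mul_one, Matrix.trace_smul,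
    hω.1.2, smul_eq_mul, mul_one]

end FreeStates

/-! ### The matrix `Ω(ρ)` and the program defining the min-entropy. -/

section MinEntropy

variable {a b n : ℕ}

theorem natCast_smul_thetaMatrix (ω : Fin n → Matrix (Fin a) (Fin a) ℂ)
    (σ : Fin n → Matrix (Fin b) (Fin b) ℂ) :
    (n : ℂ) • thetaMatrix ω σ = ∑ l, (ω l)ᵀ ⊗ₖ σ l := by
  -- For `n = 0` the default value `0⁻¹ = 0` is harmless: the sum is empty.
  rcases Nat.eq_zero_or_pos n with rfl | h
  · simp
  · have : (n : ℂ) ≠ 0 := by exact_mod_cast h.ne'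
    rw [thetaMatrix, smul_smul, mul_inv_cancel₀ this, one_smul]

theorem omegaMatrix_eq (η : Matrix (Fin a) (Fin a) ℂ) (ω : Fin n → Matrix (Fin a) (Fin a) ℂ)
    (σ : Fin n → Matrix (Fin b) (Fin b) ℂ) (ρ : Matrix (Fin b) (Fin b) ℂ) :
    omegaMatrix η ω σ ρ = ((n : ℝ) + 1)⁻¹ • (ηᵀ ⊗ₖ ρ + ∑ l, (ω l)ᵀ ⊗ₖ σ l) := by
  rw [omegaMatrix, natCast_smul_thetaMatrix, ← Complex.coe_smul]
  push_cast
  rfl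

theorem omegaMatrix_posSemidef_trace {η : Matrix (Fin a) (Fin a) ℂ}
    {ω : Fin n → Matrix (Fin a) (Fin a) ℂ} {σ : Fin n → Matrix (Fin b) (Fin b) ℂ}
    {ρ : Matrix (Fin b) (Fin b) ℂ} (hη : η ∈ densityMatrices a)
    (hω : ∀ l, ω l ∈ densityMatrices a) (hσ : ∀ l, σ l ∈ densityMatrices b)
    (hρ : ρ ∈ densityMatrices b) :
    (omegaMatrix η ω σ ρ).PosSemidef ∧ (omegaMatrix η ω σ ρ).trace = 1 := by
  rw [omegaMatrix_eq]
  constructor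
  · exact ((hη.1.transpose.kronecker hρ.1).add (Matrix.posSemidef_sum _ fun l _ =>
      (hω l).1.transpose.kronecker (hσ l).1)).smul (by positivity)
  · rw [Matrix.trace_smul, Matrix.trace_add, Matrix.trace_sum]
    simp only [Matrix.trace_kronecker, Matrix.trace_transpose, hη.2, hρ.2, (hω _).2, (hσ _).2,
      mul_one, Finset.sum_const, Finset.card_univ, Fintype.card_fin, nsmul_eq_mul]
    rw [Complex.real_smul]
    have : (n : ℂ) + 1 ≠ 0 := by exact_mod_cast n.succ_ne_zero
    push_cast
    rw [add_comm 1, inv_mul_cancel₀ this]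

theorem posSemidef_of_one_kronecker (ha : 0 < a) {τ : Matrix (Fin b) (Fin b) ℂ}
    (h : ((1 : Matrix (Fin a) (Fin a) ℂ) ⊗ₖ τ).PosSemidef) : τ.PosSemidef := by
  have h1 := h.submatrix fun i : Fin b => ((⟨0, ha⟩ : Fin a), i)
  have h2 : ((1 : Matrix (Fin a) (Fin a) ℂ) ⊗ₖ τ).submatrix (fun i : Fin b => ((⟨0, ha⟩ : Fin a), i))
      (fun i : Fin b => ((⟨0, ha⟩ : Fin a), i)) = τ := by
    ext i j
    simp
  rwa [h2] at h1

/-- The values of the program that defines the conditional min-entropy. -/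
def minEntropyValues (Ω : Matrix (Fin a × Fin b) (Fin a × Fin b) ℂ) : Set ℝ :=
  {r : ℝ | ∃ τ : Matrix (Fin b) (Fin b) ℂ, τ.PosSemidef ∧
    ((1 : Matrix (Fin a) (Fin a) ℂ) ⊗ₖ τ - Ω).PosSemidef ∧ r = τ.trace.re}

variable {Ω : Matrix (Fin a × Fin b) (Fin a × Fin b) ℂ}

theorem minEntropyValues_nonempty (hΩ : Ω.IsHermitian) : (minEntropyValues Ω).Nonempty := by
  obtain ⟨c, hc, h⟩ := hΩ.neg.exists_smul_one_add_posSemidef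
  refine ⟨_, c • 1, Matrix.PosSemidef.one.smul hc.le, ?_, rfl⟩
  rw [Matrix.kronecker_smul, Matrix.one_kronecker_one, sub_eq_add_neg]
  exact h c le_rfl

theorem inv_le_of_mem_minEntropyValues (ha : 0 < a) (ht : Ω.trace = 1) {r : ℝ}
    (hr : r ∈ minEntropyValues Ω) : (a : ℝ)⁻¹ ≤ r := by
  obtain ⟨τ, -, h, rfl⟩ := hr
  have h1 := (Complex.le_def.mp h.trace_nonneg).1
  rw [Matrix.trace_sub, Matrix.trace_kronecker, ht, Matrix.trace_one, Fintype.card_fin] at h1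
  simp at h1
  rw [inv_le_iff_one_le_mul₀' (by exact_mod_cast ha)]
  exact h1

/-- The exponential cancels the logarithm only if the infimum is positive; taking traces in `1 ⊗ τ ≥
Ω` bounds it below by `1/a`. -/
theorem two_rpow_neg_condMinEntropy (ha : 0 < a) (hΩ : Ω.IsHermitian) (ht : Ω.trace = 1) :
    (2 : ℝ) ^ (-condMinEntropy Ω) = sInf (minEntropyValues Ω) := by
  have h : 0 < sInf (minEntropyValues Ω) :=
    lt_of_lt_of_le (by positivity : 0 < (a : ℝ)⁻¹) (le_csInf (minEntropyValues_nonempty hΩ)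
      fun r hr => inv_le_of_mem_minEntropyValues ha ht hr)
  rw [condMinEntropy, neg_neg]
  exact Real.rpow_logb two_pos (by norm_num) h

end MinEntropy

theorem Matrix.kronecker_sub {m n : Type*} (A : Matrix m m ℂ) (B C : Matrix n n ℂ) :
    A ⊗ₖ (B - C) = A ⊗ₖ B - A ⊗ₖ C := by
  ext
  simp [mul_sub]

theorem Matrix.sub_kronecker {m n : Type*} (A B : Matrix m m ℂ) (C : Matrix n n ℂ) :
    (A - B) ⊗ₖ C = A ⊗ₖ C - B ⊗ₖ C := by
  ext
  simp [sub_mul]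

/-! ### Separation: a Choi matrix or a dual certificate. -/

section Duality

variable {d d' n : ℕ}

theorem isHermitian_choiMap {J : Matrix (Fin d' × Fin d) (Fin d' × Fin d) ℂ} (hJ : J.IsHermitian)
    {X : Matrix (Fin d) (Fin d) ℂ} (hX : X.IsHermitian) : (choiMap J X).IsHermitian := by
  refine Matrix.IsHermitian.ext fun a b => ?_
  rw [choiMap_apply, choiMap_apply, Finset.sum_comm]
  simp only [star_sum, star_mul', hJ.apply, hX.apply]

theorem isHermitian_partialTraceLeft {J : Matrix (Fin d' × Fin d) (Fin d' × Fin d) ℂ}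
    (hJ : J.IsHermitian) : (partialTraceLeft J).IsHermitian := by
  refine Matrix.IsHermitian.ext fun a b => ?_
  simp only [partialTraceLeft_apply, star_sum, hJ.apply]

/-- Real functionals on the space of constraint values split into their components. -/
theorem map_eq_sum_components {M N P : Type*} [AddCommGroup M] [Module ℝ M] [AddCommGroup N]
    [Module ℝ N] [AddCommGroup P] [Module ℝ P] (f : M × N × (Fin n → P) →ₗ[ℝ] ℝ)
    (x : M) (y : N) (z : Fin n → P) :
    f (x, y, z) = (f ∘ₗ LinearMap.inl ℝ M (N × (Fin n → P))) x
      + (f ∘ₗ LinearMap.inr ℝ M (N × (Fin n → P)) ∘ₗ LinearMap.inl ℝ N (Fin n → P)) y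
      + ∑ l, (f ∘ₗ LinearMap.inr ℝ M (N × (Fin n → P)) ∘ₗ LinearMap.inr ℝ N (Fin n → P) ∘ₗ
          LinearMap.single ℝ (fun _ => P) l) (z l) := by
  simp only [LinearMap.comp_apply]
  rw [← map_sum, ← map_sum, ← map_sum, ← map_add, ← map_add]
  congr 1
  have : ∑ l, LinearMap.single ℝ (fun _ : Fin n => P) l (z l) = z :=
    Finset.univ_sum_single z
  rw [this]
  simp

/-- Either there is a channel with the prescribed values, or a dual certificate excludes it. -/
theorem exists_choi_or_certificate (hd : 0 < d) (V : Submodule ℝ (Matrix (Fin d') (Fin d') ℂ))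
    {ρ : Matrix (Fin d) (Fin d) ℂ} (hρ : ρ.IsHermitian)
    {ρ' : Matrix (Fin d') (Fin d') ℂ} (hρ' : ρ'.IsHermitian)
    {σ : Fin n → Matrix (Fin d) (Fin d) ℂ} (hσ : ∀ l, (σ l).IsHermitian) :
    (∃ J : Matrix (Fin d' × Fin d) (Fin d' × Fin d) ℂ, J.PosSemidef ∧ partialTraceLeft J = 1 ∧
      choiMap J ρ = ρ' ∧ ∀ l, choiMap J (σ l) ∈ V) ∨
    ∃ (τ : Matrix (Fin d) (Fin d) ℂ) (H : Matrix (Fin d') (Fin d') ℂ)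
      (X : Fin n → Matrix (Fin d') (Fin d') ℂ), H.IsHermitian ∧ (∀ l, (X l).IsHermitian) ∧
      ((1 : Matrix (Fin d') (Fin d') ℂ) ⊗ₖ τ - (Hᵀ ⊗ₖ ρ + ∑ l, (X l)ᵀ ⊗ₖ σ l)).PosSemidef ∧
      τ.trace.re < (H * ρ').trace.re ∧
      ∀ l, ∀ Y ∈ V, Y.IsHermitian → (X l * Y).trace.re = 0 := by
  let Φ : Matrix (Fin d' × Fin d) (Fin d' × Fin d) ℂ →
      Matrix (Fin d) (Fin d) ℂ × Matrix (Fin d') (Fin d') ℂ ×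
        (Fin n → Matrix (Fin d') (Fin d') ℂ) :=
    fun J => (partialTraceLeft J, choiMap J ρ, fun l => choiMap J (σ l))
  have hΦ : IsLinearMap ℝ Φ := by
    constructor
    · intro J K
      refine Prod.ext (isLinearMap_partialTraceLeft.map_add J K) (Prod.ext
        ((isLinearMap_choiMap_apply ρ).map_add J K) ?_)
      funext l
      exact (isLinearMap_choiMap_apply (σ l)).map_add J K
    · intro c J
      refine Prod.ext (isLinearMap_partialTraceLeft.map_smul c J) (Prod.ext
        ((isLinearMap_choiMap_apply ρ).map_smul c J) ?_)
      funext l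
      exact (isLinearMap_choiMap_apply (σ l)).map_smul c J
  have hΦc : Continuous Φ := (IsLinearMap.mk' Φ hΦ).continuous_of_finiteDimensional
  -- Partial trace `1` forces trace `d`; imposing this in advance makes the set compact and loses no
  -- candidate.
  set K : Set (Matrix (Fin d' × Fin d) (Fin d' × Fin d) ℂ) :=
    {J | J.PosSemidef ∧ J.trace = (d : ℝ)} with hK
  set W : Set (Matrix (Fin d) (Fin d) ℂ × Matrix (Fin d') (Fin d') ℂ ×
      (Fin n → Matrix (Fin d') (Fin d') ℂ)) :=
    {1} ×ˢ ({ρ'} ×ˢ (Set.univ.pi fun _ => (V : Set (Matrix (Fin d') (Fin d') ℂ)))) with hW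
  by_cases hdis : Disjoint (Φ '' K) W
  · right
    have hWc : Convex ℝ W := (convex_singleton _).prod ((convex_singleton _).prod
      (convex_pi fun _ _ => V.convex))
    have hWcl : IsClosed W := isClosed_singleton.prod (isClosed_singleton.prod
      (isClosed_set_pi fun _ _ => V.closed_of_finiteDimensional))
    obtain ⟨f, u, v, hfK, huv, hfW⟩ := geometric_hahn_banach_compact_closed
      ((Matrix.convex_posSemidef_trace (d : ℝ)).is_linear_image hΦ)
      ((Matrix.isCompact_posSemidef_trace (d : ℝ)).image hΦc) hWc hWcl hdis
    have hf := map_eq_sum_components f.toLinearMap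
    obtain ⟨T, hT, hfT⟩ := Matrix.exists_isHermitian_forall_eq_trace_mul
      (f.toLinearMap ∘ₗ LinearMap.inl ℝ _ _)
    obtain ⟨H, hH, hfH⟩ := Matrix.exists_isHermitian_forall_eq_trace_mul
      (f.toLinearMap ∘ₗ LinearMap.inr ℝ _ _ ∘ₗ LinearMap.inl ℝ _ _)
    choose X hX hfX using fun l => Matrix.exists_isHermitian_forall_eq_trace_mul
      (f.toLinearMap ∘ₗ LinearMap.inr ℝ _ _ ∘ₗ LinearMap.inr ℝ _ _ ∘ₗ
        LinearMap.single ℝ (fun _ => Matrix (Fin d') (Fin d') ℂ) l)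
    -- A functional bounded below on a line is constant on it: otherwise the multiple chosen here
    -- gives `f` exactly the excluded value `v`.
    have hfW0 : ∀ Z : Fin n → Matrix (Fin d') (Fin d') ℂ, (∀ l, Z l ∈ V) → f (0, 0, Z) = 0 := by
      intro Z hZ
      by_contra hne
      have h := hfW (1, ρ', ((v - f (1, ρ', 0)) / f (0, 0, Z)) • Z)
        ⟨rfl, rfl, fun l _ => V.smul_mem _ (hZ l)⟩
      have e : ((1, ρ', ((v - f (1, ρ', 0)) / f (0, 0, Z)) • Z) : Matrix (Fin d) (Fin d) ℂ ×
          Matrix (Fin d') (Fin d') ℂ × (Fin n → Matrix (Fin d') (Fin d') ℂ))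
          = (1, ρ', 0) + ((v - f (1, ρ', 0)) / f (0, 0, Z)) • (0, 0, Z) := by
        simp
      rw [e, map_add, map_smul, smul_eq_mul, div_mul_cancel₀ _ hne] at h
      linarith
    refine ⟨(u / d) • 1 - T, H, X, hH, hX, ?_, ?_, ?_⟩
    · set M : Matrix (Fin d' × Fin d) (Fin d' × Fin d) ℂ :=
        (1 : Matrix (Fin d') (Fin d') ℂ) ⊗ₖ T + (Hᵀ ⊗ₖ ρ + ∑ l, (X l)ᵀ ⊗ₖ σ l) with hM
      have hMH : M.IsHermitian := by
        have hk : ∀ {A : Matrix (Fin d') (Fin d') ℂ} {B : Matrix (Fin d) (Fin d) ℂ},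
            A.IsHermitian → B.IsHermitian → (A ⊗ₖ B).IsHermitian := fun hA hB => by
          rw [Matrix.IsHermitian, Matrix.conjTranspose_kronecker, hA.eq, hB.eq]
        refine (hk Matrix.isHermitian_one hT).add ((hk hH.transpose hρ).add ?_)
        rw [Matrix.IsHermitian, Matrix.conjTranspose_sum]
        exact Finset.sum_congr rfl fun l _ => (hk (hX l).transpose (hσ l)).eq
      have hfM : ∀ J : Matrix (Fin d' × Fin d) (Fin d' × Fin d) ℂ, J.IsHermitian →
          f (Φ J) = (J * M).trace.re := by
        intro J hJ
        refine (hf _ _ _).trans ?_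
        rw [hfT _ (isHermitian_partialTraceLeft hJ), hfH _ (isHermitian_choiMap hJ hρ)]
        simp only [hfX _ _ (isHermitian_choiMap hJ (hσ _))]
        rw [hM, Matrix.mul_add, Matrix.mul_add, Matrix.mul_sum, Matrix.trace_add,
          Matrix.trace_add, Matrix.trace_sum, trace_mul_partialTraceLeft, trace_mul_choiMap]
        simp only [trace_mul_choiMap, Complex.add_re, Complex.re_sum]
        ring
      -- Rescaling a nonzero `J ≥ 0` to trace `d` puts it in `K`, where `f ∘ Φ`, which is the
      -- pairing with `M`, stays below `u`.
      have hle := hMH.smul_one_sub_posSemidef (u / d) fun J hJ => by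
        have ht := hJ.trace_nonneg
        have htre : J.trace = (J.trace.re : ℂ) := Complex.ext rfl (Complex.le_def.mp ht).2.symm
        have hd0 : (0 : ℝ) < d := by exact_mod_cast hd
        rcases (Complex.le_def.mp ht).1.eq_or_lt with h0 | hpos
        · have : J = 0 := by
            rw [← hJ.trace_eq_zero_iff, htre, ← h0]
            simp
          simp [this]
        · have hpos' : 0 < J.trace.re := hpos
          have hs : ((d / J.trace.re : ℝ) • J) ∈ K := by
            refine ⟨hJ.smul (by positivity), ?_⟩
            rw [Matrix.trace_smul, htre, Complex.real_smul, ← Complex.ofReal_mul,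
              Complex.ofReal_re, div_mul_cancel₀ _ hpos'.ne']
          have h := hfK _ ⟨_, hs, rfl⟩
          rw [hΦ.map_smul, map_smul, hfM J hJ.isHermitian, smul_eq_mul, div_mul_eq_mul_div,
            div_lt_iff₀ hpos'] at h
          rw [div_mul_eq_mul_div, le_div_iff₀ hd0]
          linarith
      have e : (1 : Matrix (Fin d') (Fin d') ℂ) ⊗ₖ ((u / d) • (1 : Matrix (Fin d) (Fin d) ℂ) - T)
          - (Hᵀ ⊗ₖ ρ + ∑ l, (X l)ᵀ ⊗ₖ σ l) = (u / d) • 1 - M := by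
        rw [Matrix.kronecker_sub, Matrix.kronecker_smul, Matrix.one_kronecker_one, hM]
        abel
      rw [e]
      exact hle
    -- Here `v < Tr T + Tr[H ρ']`, while the certificate has trace `u - Tr T` and `u < v`.
    · have h := hfW (1, ρ', 0) ⟨rfl, rfl, fun l _ => V.zero_mem⟩
      have h2 := hf 1 ρ' 0
      rw [hfT _ Matrix.isHermitian_one, hfH _ hρ'] at h2
      simp only [Pi.zero_apply, map_zero, Finset.sum_const_zero, add_zero, Matrix.mul_one] at h2
      have h3 : f (1, ρ', 0) = T.trace.re + (H * ρ').trace.re := h2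
      rw [Matrix.trace_sub, Matrix.trace_smul, Matrix.trace_one, Fintype.card_fin, Complex.sub_re,
        Complex.smul_re, Complex.natCast_re, smul_eq_mul,
        div_mul_cancel₀ _ (by exact_mod_cast hd.ne')]
      linarith
    · intro l Y hY hYH
      rw [← hfX l Y hYH]
      refine hfW0 (Pi.single l Y) fun k => ?_
      rcases eq_or_ne k l with rfl | hk
      · rwa [Pi.single_eq_same]
      · rw [Pi.single_eq_of_ne hk]
        exact V.zero_mem
  · left
    obtain ⟨_, ⟨J, hJ, rfl⟩, h1, h2, h3⟩ := Set.not_disjoint_iff.mp hdis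
    exact ⟨J, hJ.1, h1, h2, fun l => h3 l trivial⟩

end Duality

/-! ### Necessity and sufficiency of the entropic inequality. -/

section Conversion

variable {d d' n : ℕ} {FIn : Set (Matrix (Fin d) (Fin d) ℂ)}
  {FOut : Set (Matrix (Fin d') (Fin d') ℂ)}

theorem IsRNG.le_two_rpow_neg_condMinEntropy
    {E : Matrix (Fin d) (Fin d) ℂ →ₗ[ℂ] Matrix (Fin d') (Fin d') ℂ} (hE : IsRNG FIn FOut E)
    (hIn : FIn ⊆ densityMatrices d) (hmix : maximallyMixed d' ∈ FOut)
    {ρ : Matrix (Fin d) (Fin d) ℂ} (hρ : ρ ∈ densityMatrices d)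
    {η : Matrix (Fin d') (Fin d') ℂ} (hη : η ∈ densityMatrices d')
    {ω : Fin n → Matrix (Fin d') (Fin d') ℂ} (hω : ∀ l, ω l ∈ dualStates FOut)
    {σ : Fin n → Matrix (Fin d) (Fin d) ℂ} (hσ : ∀ l, σ l ∈ FIn) :
    ((n : ℝ) + d' * (η * E ρ).trace.re) / (d' * ((n : ℝ) + 1)) ≤
      (2 : ℝ) ^ (-condMinEntropy (omegaMatrix η ω σ ρ)) := by
  have hd' := pos_of_mem_densityMatrices hη
  have hΩ := omegaMatrix_posSemidef_trace hη (fun l => (hω l).1) (fun l => hIn (hσ l)) hρ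
  rw [two_rpow_neg_condMinEntropy hd' hΩ.1.isHermitian hΩ.2]
  refine le_csInf (minEntropyValues_nonempty hΩ.1.isHermitian) ?_
  rintro _ ⟨τ, -, h, rfl⟩
  have h1 := (Complex.le_def.mp (entangledOverlap_nonneg hE.1 h)).1
  have h2 : entangledOverlap E ((1 : Matrix (Fin d') (Fin d') ℂ) ⊗ₖ τ) = τ.trace := by
    rw [← Matrix.transpose_one, entangledOverlap_transpose_kronecker, Matrix.one_mul, hE.1.2]
  have h3 : ∀ l, (ω l * E (σ l)).trace = (d' : ℂ)⁻¹ := fun l =>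
    trace_mul_eq_of_mem_dualStates hmix (hω l) (hE.2 _ (hσ l))
  rw [omegaMatrix_eq, map_sub, h2, LinearMap.map_smul_of_tower, map_add, map_sum] at h1
  simp only [entangledOverlap_transpose_kronecker, h3, Finset.sum_const, Finset.card_univ,
    Fintype.card_fin, nsmul_eq_mul, Complex.zero_re, Complex.sub_re, Complex.smul_re,
    Complex.add_re, smul_eq_mul] at h1
  have h4 : ((n : ℂ) * (d' : ℂ)⁻¹).re = n * (d' : ℝ)⁻¹ := by
    rw [← Complex.ofReal_re (n * (d' : ℝ)⁻¹)]
    push_cast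
    rfl
  rw [h4] at h1
  have hd0 : (0 : ℝ) < d' := by exact_mod_cast hd'
  have e : ((n : ℝ) + d' * (η * E ρ).trace.re) / (d' * ((n : ℝ) + 1))
      = ((n : ℝ) + 1)⁻¹ * ((η * E ρ).trace.re + n * (d' : ℝ)⁻¹) := by
    field_simp
    ring
  rw [e]
  linarith

/-- A dual certificate against the conversion yields dual states that violate the entropic
inequality. -/
theorem exists_two_rpow_neg_condMinEntropy_lt (hOut : FOut ⊆ densityMatrices d')
    (hmix : maximallyMixed d' ∈ FOut)
    {ρ : Matrix (Fin d) (Fin d) ℂ} (hρ : ρ ∈ densityMatrices d)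
    {ρ' : Matrix (Fin d') (Fin d') ℂ} (hρ' : ρ' ∈ densityMatrices d')
    {σ : Fin n → Matrix (Fin d) (Fin d) ℂ} (hσ : ∀ l, σ l ∈ densityMatrices d)
    {τ : Matrix (Fin d) (Fin d) ℂ} {H : Matrix (Fin d') (Fin d') ℂ}
    {X : Fin n → Matrix (Fin d') (Fin d') ℂ} (hH : H.IsHermitian) (htH : H.trace = 0)
    (hX : ∀ l, (X l).IsHermitian)
    (hle : ((1 : Matrix (Fin d') (Fin d') ℂ) ⊗ₖ τ
      - (Hᵀ ⊗ₖ ρ + ∑ l, (X l)ᵀ ⊗ₖ σ l)).PosSemidef)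
    (hlt : τ.trace.re < (H * ρ').trace.re)
    (hXF : ∀ l, ∀ Y ∈ FOut, (X l * Y).trace = 0) :
    ∃ η ∈ densityMatrices d', ∃ ω : Fin n → Matrix (Fin d') (Fin d') ℂ,
      (∀ l, ω l ∈ dualStates FOut) ∧
      (2 : ℝ) ^ (-condMinEntropy (omegaMatrix η ω σ ρ)) <
        ((n : ℝ) + d' * (η * ρ').trace.re) / (d' * ((n : ℝ) + 1)) := by
  have hd' := pos_of_mem_densityMatrices hρ'
  have hd0 : (0 : ℝ) < d' := by exact_mod_cast hd'
  obtain ⟨c₀, hc₀, hcH⟩ := hH.exists_smul_one_add_posSemidef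
  choose c hc hcX using fun l => (hX l).exists_smul_one_add_posSemidef
  -- One scale for all perturbations, so that the certificate inequality is rescaled as a whole.
  set C : ℝ := c₀ + ∑ l, c l with hC
  have hsum : 0 ≤ ∑ l, c l := Finset.sum_nonneg fun l _ => (hc l).le
  have hCpos : 0 < C := by linarith
  have hCl : ∀ l, c l ≤ C := fun l => by
    have := Finset.single_le_sum (f := c) (fun i _ => (hc i).le) (Finset.mem_univ l)
    linarith
  have htX : ∀ l, (X l).trace = 0 := by
    intro l
    have h := hXF l _ hmix
    rw [maximallyMixed, Matrix.mul_smul, Matrix.mul_one, Matrix.trace_smul, smul_eq_mul,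
      mul_eq_zero] at h
    exact h.resolve_left (inv_ne_zero (by exact_mod_cast hd'.ne'))
  set η : Matrix (Fin d') (Fin d') ℂ := (d' : ℝ)⁻¹ • (1 + C⁻¹ • H) with hηdef
  set ω : Fin n → Matrix (Fin d') (Fin d') ℂ := fun l => (d' : ℝ)⁻¹ • (1 + C⁻¹ • X l) with hωdef
  have hη : η ∈ densityMatrices d' :=
    perturbation_mem_densityMatrices hd' htH hCpos (hcH C (by linarith))
  have hω : ∀ l, ω l ∈ dualStates FOut := fun l => mem_dualStates_of_trace_mul hOut
    (perturbation_mem_densityMatrices hd' (htX l) hCpos (hcX l C (hCl l))) (hXF l)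
  refine ⟨η, hη, ω, hω, ?_⟩
  have hΩ := omegaMatrix_posSemidef_trace hη (fun l => (hω l).1) hσ hρ
  rw [two_rpow_neg_condMinEntropy hd' hΩ.1.isHermitian hΩ.2]
  -- The identity parts of `η` and `ω l` contribute `1 ⊗ (ρ + ∑ l, σ l)` to `Ω`, which is matched
  -- exactly; what remains is the rescaled certificate inequality.
  set τ' : Matrix (Fin d) (Fin d) ℂ :=
    ((n : ℝ) + 1)⁻¹ • (d' : ℝ)⁻¹ • ((ρ + ∑ l, σ l) + C⁻¹ • τ) with hτ'
  have hdiff : (1 : Matrix (Fin d') (Fin d') ℂ) ⊗ₖ τ' - omegaMatrix η ω σ ρ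
      = ((n : ℝ) + 1)⁻¹ • (d' : ℝ)⁻¹ • C⁻¹ • ((1 : Matrix (Fin d') (Fin d') ℂ) ⊗ₖ τ
        - (Hᵀ ⊗ₖ ρ + ∑ l, (X l)ᵀ ⊗ₖ σ l)) := by
    have hk : ∀ (Y : Matrix (Fin d') (Fin d') ℂ) (Z : Matrix (Fin d) (Fin d) ℂ),
        ((d' : ℝ)⁻¹ • (1 + C⁻¹ • Y))ᵀ ⊗ₖ Z
          = (d' : ℝ)⁻¹ • ((1 : Matrix (Fin d') (Fin d') ℂ) ⊗ₖ Z + C⁻¹ • (Yᵀ ⊗ₖ Z)) := by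
      intro Y Z
      rw [Matrix.transpose_smul, Matrix.transpose_add, Matrix.transpose_one,
        Matrix.transpose_smul, Matrix.smul_kronecker, Matrix.add_kronecker, Matrix.smul_kronecker]
    have hs : (1 : Matrix (Fin d') (Fin d') ℂ) ⊗ₖ (∑ l, σ l)
        = ∑ l, (1 : Matrix (Fin d') (Fin d') ℂ) ⊗ₖ σ l := by
      ext ⟨a, i⟩ ⟨b, j⟩
      simp [Matrix.sum_apply, Finset.mul_sum]
    rw [omegaMatrix_eq, hηdef, hωdef, hτ']
    simp only [hk]
    rw [Matrix.kronecker_smul, Matrix.kronecker_smul, Matrix.kronecker_add, Matrix.kronecker_add,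
      Matrix.kronecker_smul, hs, ← Finset.smul_sum, Finset.sum_add_distrib, ← Finset.smul_sum]
    simp only [smul_add, smul_sub]
    abel
  have hfeas : ((1 : Matrix (Fin d') (Fin d') ℂ) ⊗ₖ τ' - omegaMatrix η ω σ ρ).PosSemidef := by
    rw [hdiff]
    exact ((hle.smul (inv_nonneg.mpr hCpos.le)).smul (by positivity)).smul (by positivity)
  -- The certificate `τ` need not be positive, but `1 ⊗ τ' ≥ Ω ≥ 0`.
  have hτ'pos : τ'.PosSemidef := by
    refine posSemidef_of_one_kronecker hd' ?_
    have := hfeas.add hΩ.1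
    rwa [sub_add_cancel] at this
  have hbdd : BddBelow (minEntropyValues (omegaMatrix η ω σ ρ)) :=
    ⟨_, fun r hr => inv_le_of_mem_minEntropyValues hd' hΩ.2 hr⟩
  refine (csInf_le hbdd ⟨τ', hτ'pos, hfeas, rfl⟩).trans_lt ?_
  have htτ : τ'.trace.re = ((n : ℝ) + 1)⁻¹ * ((d' : ℝ)⁻¹ * ((1 + n) + C⁻¹ * τ.trace.re)) := by
    rw [hτ', Matrix.trace_smul, Matrix.trace_smul, Matrix.trace_add, Matrix.trace_add,
      Matrix.trace_sum, Matrix.trace_smul, hρ.2]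
    simp only [(hσ _).2, Complex.smul_re, Complex.add_re, Complex.one_re, Complex.natCast_re,
      Finset.sum_const, Finset.card_univ, Fintype.card_fin, nsmul_eq_mul, mul_one, smul_eq_mul]
  have htη : (η * ρ').trace.re = (d' : ℝ)⁻¹ * (1 + C⁻¹ * (H * ρ').trace.re) := by
    rw [hηdef, trace_perturbation_mul, hρ'.2]
    simp only [Complex.smul_re, Complex.add_re, Complex.one_re, smul_eq_mul]
  have e : ((n : ℝ) + d' * (η * ρ').trace.re) / (d' * ((n : ℝ) + 1))
      = ((n : ℝ) + 1)⁻¹ * ((d' : ℝ)⁻¹ * ((1 + n) + C⁻¹ * (H * ρ').trace.re)) := by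
    rw [htη]
    field_simp
    ring
  rw [htτ, e]
  gcongr

theorem exists_isRNG_of_forall_le (hIn : FIn ⊆ densityMatrices d) (hOut : IsAffineStateSet FOut)
    (hmix : maximallyMixed d' ∈ FOut)
    {ρ : Matrix (Fin d) (Fin d) ℂ} (hρ : ρ ∈ densityMatrices d)
    {ρ' : Matrix (Fin d') (Fin d') ℂ} (hρ' : ρ' ∈ densityMatrices d')
    {σ : Fin n → Matrix (Fin d) (Fin d) ℂ} (hσ : ∀ l, σ l ∈ FIn)
    (hspan : Submodule.span ℝ (Set.range σ) = realSpan FIn)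
    (h : ∀ η ∈ densityMatrices d', ∀ ω : Fin n → Matrix (Fin d') (Fin d') ℂ,
      (∀ l, ω l ∈ dualStates FOut) →
      ((n : ℝ) + d' * (η * ρ').trace.re) / (d' * ((n : ℝ) + 1)) ≤
        (2 : ℝ) ^ (-condMinEntropy (omegaMatrix η ω σ ρ))) :
    ∃ E, IsRNG FIn FOut E ∧ E ρ = ρ' := by
  have hd' := pos_of_mem_densityMatrices hρ'
  rcases exists_choi_or_certificate (pos_of_mem_densityMatrices hρ) (realSpan FOut)
    hρ.1.isHermitian hρ'.1.isHermitian (fun l => (hIn (hσ l)).1.isHermitian) with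
    ⟨J, hJ, hJ1, hJρ, hJσ⟩ | ⟨τ, H, X, hH, hX, hle, hlt, hXV⟩
  · have hch := isChannel_choiMap hJ hJ1
    refine ⟨choiMap J, ⟨hch, fun s hs => ?_⟩, hJρ⟩
    refine hOut.mem_of_mem_realSpan (hch.map_densityMatrices (hIn hs)) ?_
    have hs' : s ∈ Submodule.span ℝ (Set.range σ) := by
      rw [hspan]
      exact Submodule.subset_span hs
    have hsub : Submodule.span ℝ (Set.range σ)
        ≤ (realSpan FOut).comap ((choiMap J).restrictScalars ℝ) := by
      rw [Submodule.span_le]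
      rintro _ ⟨l, rfl⟩
      exact hJσ l
    exact hsub hs'
  · exfalso
    have hXF : ∀ l, ∀ Y ∈ FOut, (X l * Y).trace = 0 := fun l Y hY =>
      have hYH := (hOut.1 hY).1.isHermitian
      Complex.ext (hXV l Y (Submodule.subset_span hY) hYH) ((hX l).trace_mul_im hYH)
    -- Replacing `H` by `H - s • 1` and `τ` by `τ - s • ρ` leaves the operator inequality unchanged
    -- and lowers both sides of the strict inequality by `s`; this `s` makes `H` traceless.
    set s : ℝ := H.trace.re / d' with hs
    have hd0 : (d' : ℝ) ≠ 0 := by exact_mod_cast hd'.ne'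
    have htH : (H - s • 1).trace = 0 := by
      have him : H.trace.im = 0 := by
        have := hH.trace_mul_im (Y := 1) Matrix.isHermitian_one
        rwa [Matrix.mul_one] at this
      rw [Matrix.trace_sub, Matrix.trace_smul, Matrix.trace_one, Fintype.card_fin]
      apply Complex.ext
      · simp [hs, div_mul_cancel₀ _ hd0]
      · simp [him]
    have hle' : ((1 : Matrix (Fin d') (Fin d') ℂ) ⊗ₖ (τ - s • ρ)
        - ((H - s • 1)ᵀ ⊗ₖ ρ + ∑ l, (X l)ᵀ ⊗ₖ σ l)).PosSemidef := by
      convert hle using 1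
      rw [Matrix.transpose_sub, Matrix.transpose_smul, Matrix.transpose_one,
        Matrix.kronecker_sub, Matrix.sub_kronecker, Matrix.kronecker_smul, Matrix.smul_kronecker]
      abel
    obtain ⟨η, hη, ω, hω, hlt'⟩ := exists_two_rpow_neg_condMinEntropy_lt hOut.1 hmix hρ hρ'
      (fun l => hIn (hσ l)) (hH.sub (Matrix.isHermitian_one.smul (IsSelfAdjoint.all s))) htH hX
      hle' (by
        rw [Matrix.trace_sub, Matrix.trace_smul, hρ.2, Matrix.sub_mul, Matrix.smul_mul,
          Matrix.one_mul, Matrix.trace_sub, Matrix.trace_smul, hρ'.2]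
        simpa using hlt) hXF
    exact absurd (h η hη ω hω) (not_le.mpr hlt')

end Conversion

theorem mainTheorem5 (d d' : ℕ)
    (FIn : Set (Matrix (Fin d) (Fin d) ℂ)) (FOut : Set (Matrix (Fin d') (Fin d') ℂ))
    (hIn : IsAffineStateSet FIn) (hOut : IsAffineStateSet FOut) (hne : FIn.Nonempty)
    (hmix : maximallyMixed d' ∈ FOut)
    (ρ : Matrix (Fin d) (Fin d) ℂ) (hρ : ρ ∈ densityMatrices d)
    (ρ' : Matrix (Fin d') (Fin d') ℂ) (hρ' : ρ' ∈ densityMatrices d') :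
    (∀ σ : Fin (spanDim FIn) → Matrix (Fin d) (Fin d) ℂ, (∀ l, σ l ∈ FIn) →
      Submodule.span ℝ (Set.range σ) = realSpan FIn →
      ((∃ E, IsRNG FIn FOut E ∧ E ρ = ρ') ↔
        ∀ η ∈ densityMatrices d', ∀ ω : Fin (spanDim FIn) → Matrix (Fin d') (Fin d') ℂ,
          (∀ l, ω l ∈ dualStates FOut) →
          ((spanDim FIn : ℝ) + (d' : ℝ) * (η * ρ').trace.re) /
              ((d' : ℝ) * ((spanDim FIn : ℝ) + 1)) ≤
            (2 : ℝ) ^ (-condMinEntropy (omegaMatrix η ω σ ρ)))) ∧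
    ((∃ E, IsRNG FIn FOut E ∧ E ρ = ρ') ↔
      ∀ η ∈ densityMatrices d', ∀ ω : Fin (spanDim FIn) → Matrix (Fin d') (Fin d') ℂ,
        (∀ l, ω l ∈ dualStates FOut) →
        ∀ σ : Fin (spanDim FIn) → Matrix (Fin d) (Fin d) ℂ, (∀ l, σ l ∈ FIn) →
          ((spanDim FIn : ℝ) + (d' : ℝ) * (η * ρ').trace.re) /
              ((d' : ℝ) * ((spanDim FIn : ℝ) + 1)) ≤
            (2 : ℝ) ^ (-condMinEntropy (omegaMatrix η ω σ ρ))) := by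
  have hfwd : ∀ σ : Fin (spanDim FIn) → Matrix (Fin d) (Fin d) ℂ, (∀ l, σ l ∈ FIn) →
      (∃ E, IsRNG FIn FOut E ∧ E ρ = ρ') →
      ∀ η ∈ densityMatrices d', ∀ ω : Fin (spanDim FIn) → Matrix (Fin d') (Fin d') ℂ,
        (∀ l, ω l ∈ dualStates FOut) →
        ((spanDim FIn : ℝ) + (d' : ℝ) * (η * ρ').trace.re) /
            ((d' : ℝ) * ((spanDim FIn : ℝ) + 1)) ≤
          (2 : ℝ) ^ (-condMinEntropy (omegaMatrix η ω σ ρ)) := by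
    rintro σ hσ ⟨E, hE, rfl⟩ η hη ω hω
    exact hE.le_two_rpow_neg_condMinEntropy hIn.1 hmix hρ hη hω hσ
  refine ⟨fun σ hσ hspan => ⟨hfwd σ hσ, exists_isRNG_of_forall_le hIn.1 hOut hmix hρ hρ' hσ hspan⟩,
    fun hE η hη ω hω σ hσ => hfwd σ hσ hE η hη ω hω, fun h => ?_⟩
  -- A spanning family of exactly `n` free states exists, so the second criterion reduces to the
  -- sufficiency half of the first.
  obtain ⟨σ, hσ, hspan, -⟩ := Submodule.exists_fun_fin_finrank_span_eq ℝ FIn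
  exact exists_isRNG_of_forall_le hIn.1 hOut hmix hρ hρ' hσ hspan
    fun η hη ω hω => h η hη ω hω σ hσ
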